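/- Let $K$ be a non-archimedean local field with residue field of cardinality $q$, discrete valuation $w:K^\times\to\mathbb{Z}$, and normalised absolute value $|x|=q^{-w(x)}$. Fix an additive Haar measure $dx$ on $K$ and put $d^\times x=|x|^{-1}dx$ on $K^\times$. Let $\mathcal{S}(K)$ be the Schwartz--Bruhat space of locally constant, compactly supported functions $K\to\mathbb{C}$. For $g\in\mathcal{S}(K)$, a quasi-character (continuous homomorphism) $\omega:K^\times\to\mathbb{C}^\times$ and $s\in\mathbb{C}$ let \[\zeta(g,\omega,s)=\int_{K^\times}g(x)\,\omega(x)\,|x|^s\,d^\times x,\] and let $L(\omega,s)=(1-\omega(\pi)q^{-s})^{-1}$ ($\pi$ any prime of $K$) if $\omega$ is unramified, i.e. trivial on $\{x:|x|=1\}$, and $L(\omega,s)=1$ otherwise. Write $Z(g,\omega,s)$ for the entire function of $s$ which, for $\mathrm{Re}(s)$ sufficiently large, where the integral converges absolutely, equals $\zeta(g,\omega,s)/L(\omega,s)$. Let $g\mapsto g^*$ be a $\mathbb{C}$-linear endomorphism of $\mathcal{S}(K)$ which satisfies, for some integer $n$, \[g(\alpha\,\cdot)^*=|\alpha|^{-n}\,g^*(\alpha^{-1}\,\cdot)\qquad\text{for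 all } g\in\mathcal{S}(K),\ \alpha\in K^\times,\] where $g(\alpha\,\cdot)$ denotes the function $x\mapsto g(\alpha x)$. Let $\omega$ be a quasi-character of $K^\times$. Then $Z(g,\omega,s)$ is well defined (the stated entire continuation exists) for every $g\in\mathcal{S}(K)$, and there is a unique entire function $\varepsilon_*(\omega,s)$ of $s$ such that \[Z(g^*,\omega^{-1},n-s)=\varepsilon_*(\omega,s)\,Z(g,\omega,s)\qquad\text{for all } g\in\mathcal{S}(K),\ s\in\mathbb{C}.\] -/

import Mathlib

open MeasureTheory ValuativeRel

noncomputable section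

namespace LocalZeta

section

variable (K : Type*) [Field K] [ValuativeRel K] [TopologicalSpace K]
  [IsNonarchimedeanLocalField K]

/-- The cardinality `q` of the residue field. -/
def residueCard : ℕ := Nat.card 𝓀[K]

variable {K}

/-- The normalised discrete valuation `w : Kˣ → ℤ`, sending a prime to `1`.
The order isomorphism with `ℤᵐ⁰` sends the value of a prime to `exp (-1)`, whence the sign. -/
def ord (x : Kˣ) : ℤ :=
  -WithZero.log (IsNonarchimedeanLocalField.valueGroupWithZeroIsoInt K (valuation K (x : K)))

/-- The normalised absolute value `|x| = q ^ (-w(x))` on `Kˣ`. -/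
def absVal (x : Kˣ) : ℝ := (residueCard K : ℝ) ^ (-ord x)

variable (K) in
theorem exists_prime : ∃ p : Kˣ, ord p = 1 := by
  obtain ⟨γ, hγ⟩ := (IsNonarchimedeanLocalField.valueGroupWithZeroIsoInt K).surjective
    (WithZero.exp (-1))
  obtain ⟨x, hx⟩ := ValuativeRel.valuation_surjective γ
  have hx0 : x ≠ 0 := by
    rintro rfl
    rw [map_zero] at hx
    rw [← hx, map_zero] at hγ
    exact WithZero.exp_ne_zero hγ.symm
  refine ⟨Units.mk0 x hx0, ?_⟩
  have h : IsNonarchimedeanLocalField.valueGroupWithZeroIsoInt K γ = WithZero.exp (-1) := hγ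
  simp [ord, hx, h]

variable (K) in
/-- A chosen prime element of `K`. -/
def primeElt : Kˣ := (exists_prime K).choose

variable (K) in
/-- The Schwartz-Bruhat space `S(K)`: locally constant functions of compact support. -/
def SchwartzBruhat : Submodule ℂ (K → ℂ) where
  carrier := {f | IsLocallyConstant f ∧ HasCompactSupport f}
  add_mem' hf hg := ⟨hf.1.add hg.1, hf.2.add hg.2⟩
  zero_mem' := ⟨IsLocallyConstant.const 0, HasCompactSupport.zero⟩
  smul_mem' c f hf := ⟨hf.1.comp (fun z => c • z), hf.2.comp_left (g := fun z => c • z) (by simp)⟩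

/-- The function `g(α ·)`, that is `x ↦ g (α x)`. -/
def dilate (α : Kˣ) (g : SchwartzBruhat K) : SchwartzBruhat K :=
  ⟨fun x => (g : K → ℂ) ((α : K) * x),
    g.2.1.comp_continuous (continuous_const.mul continuous_id),
    g.2.2.comp_homeomorph (Homeomorph.mulLeft₀ (α : K) α.ne_zero)⟩

/-- A quasi-character is unramified if it is trivial on the units of the ring of integers. -/
def IsUnramified (ω : Kˣ →ₜ* ℂˣ) : Prop := ∀ u : Kˣ, ord u = 0 → ω u = 1

open Classical in
/-- The local L-function: `L(ω,s) = (1 - ω(π) q⁻ˢ)⁻¹` for `ω` unramified, where the choice of the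
prime `π` is immaterial, and `L(ω,s) = 1` for `ω` ramified. -/
def localL (ω : Kˣ →ₜ* ℂˣ) (s : ℂ) : ℂ :=
  if IsUnramified ω then (1 - (ω (primeElt K) : ℂ) * (residueCard K : ℂ) ^ (-s))⁻¹ else 1

variable [MeasurableSpace K]

/-- The measure `|x|⁻¹ dx` on `Kˣ` attached to a measure `dx` on `K`. -/
def mulMeasure (μ : Measure K) : Measure Kˣ :=
  (μ.comap (Units.val : Kˣ → K)).withDensity fun x => ENNReal.ofReal (absVal x)⁻¹

/-- The integrand `g(x) ω(x) |x|ˢ` of the local zeta integral. -/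
def zetaIntegrand (g : SchwartzBruhat K) (ω : Kˣ →ₜ* ℂˣ) (s : ℂ) (x : Kˣ) : ℂ :=
  (g : K → ℂ) (x : K) * (ω x : ℂ) * (absVal x : ℂ) ^ s

/-- The local zeta integral `ζ(g,ω,s)`. -/
def zetaIntegral (μ : Measure K) (g : SchwartzBruhat K) (ω : Kˣ →ₜ* ℂˣ) (s : ℂ) : ℂ :=
  ∫ x, zetaIntegrand g ω s x ∂(mulMeasure μ)

/-- `F` is an entire function which continues `ζ(g,ω,s) / L(ω,s)`, where the zeta integral
converges absolutely for `Re s` sufficiently large. -/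
def IsEntireContinuation (μ : Measure K) (g : SchwartzBruhat K) (ω : Kˣ →ₜ* ℂˣ)
    (F : ℂ → ℂ) : Prop :=
  Differentiable ℂ F ∧ ∃ σ : ℝ, ∀ s : ℂ, σ < s.re →
    Integrable (zetaIntegrand g ω s) (mulMeasure μ) ∧
      F s = zetaIntegral μ g ω s / localL ω s

open Classical in
/-- The function `Z(g,ω,s)`: the entire continuation of `ζ(g,ω,s) / L(ω,s)`
(it is unique by the identity theorem; the value `0` is used should none exist). -/
def Z (μ : Measure K) (g : SchwartzBruhat K) (ω : Kˣ →ₜ* ℂˣ) : ℂ → ℂ :=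
  if h : ∃ F : ℂ → ℂ, IsEntireContinuation μ g ω F then h.choose else 0

end

end LocalZeta

end

/-! Both $g\mapsto Z(g,\omega,s)$ and $g\mapsto Z(g^*,\omega^{-1},n-s)$ are linear functionals on
$\mathcal S(K)$ which $g\mapsto g(\alpha\,\cdot)$ multiplies by $\omega(\alpha)^{-1}|\alpha|^{-s}$
(`Z_dilate`, `Z_comp_equivariant`). Such functionals form a space of dimension at most one, so the
two are proportional.

The reason (`eq_zero_of_equivariant`): modulo $1_{\mathcal O}$ every $g$ vanishes at $0$, hence is a
finite combination of dilates of $1_V$ for a small open subgroup $V$ of $\mathcal O^\times$. If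
$\omega$ is unramified, $1_{\mathcal O^\times}=1_{\mathcal O}-1_{\mathcal O}(\pi^{-1}\cdot)$ leaves
only the value at $1_{\mathcal O}$. If $\omega$ is ramified, $1_{\mathcal O}$ is killed because it
is invariant under units on which $\omega\ne1$, and only the value at $1_V$ remains.

At the surviving test function $g_0$, $Z$ is a nonzero constant $c$, a volume
(`exists_test_function`). So $\varepsilon_*(\omega,s)=Z(g_0^*,\omega^{-1},n-s)/c$ is forced, and it
is entire. The same decomposition yields the continuation of every $Z(g,\omega,s)$. -/

noncomputable section

namespace LocalZeta

/-! ### Topology of $K$ and small open subgroups of $K^\times$ -/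

section Topology

open Topology Filter

variable {K : Type*} [Field K] [ValuativeRel K] [TopologicalSpace K]
  [IsNonarchimedeanLocalField K]

theorem ord_mul (x y : Kˣ) : ord (x * y) = ord x + ord y := by
  unfold ord
  rw [Units.val_mul, map_mul, map_mul, WithZero.log_mul (by simp) (by simp)]
  ring

theorem ord_one : ord (1 : Kˣ) = 0 := by simp [ord]

variable (K) in
/-- The normalised valuation as a homomorphism. -/
def ordHom : Kˣ →* Multiplicative ℤ where
  toFun x := Multiplicative.ofAdd (ord x)
  map_one' := by rw [ord_one]; rfl
  map_mul' x y := by rw [ord_mul]; rfl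

theorem ord_inv (x : Kˣ) : ord x⁻¹ = -ord x := by
  have := ord_mul x⁻¹ x
  rw [inv_mul_cancel, ord_one] at this
  omega

theorem ord_zpow (x : Kˣ) (k : ℤ) : ord (x ^ k) = k * ord x := by
  have := congrArg Multiplicative.toAdd (map_zpow (ordHom K) x k)
  simpa [ordHom] using this

theorem ord_primeElt : ord (primeElt K) = 1 := (exists_prime K).choose_spec

theorem ord_nonneg_iff (x : Kˣ) : 0 ≤ ord x ↔ valuation K (x : K) ≤ 1 := by
  unfold ord
  rw [neg_nonneg, WithZero.log_le_iff_le_exp (by simp), WithZero.exp_zero,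
    ← map_one (IsNonarchimedeanLocalField.valueGroupWithZeroIsoInt K)]
  exact map_le_map_iff (IsNonarchimedeanLocalField.valueGroupWithZeroIsoInt K)

theorem ord_eq_zero_iff (x : Kˣ) : ord x = 0 ↔ valuation K (x : K) = 1 := by
  have h1 := ord_nonneg_iff x
  have h2 := ord_nonneg_iff x⁻¹
  rw [ord_inv, Units.val_inv_eq_inv_val, map_inv₀,
    inv_le_one₀ (zero_lt_iff.mpr ((by simp)))] at h2
  constructor
  · intro h
    exact le_antisymm (h1.1 h.ge) (h2.1 (by omega))
  · intro h
    have := h1.2 h.le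
    have := h2.2 h.ge
    omega

/-- The valuation is locally constant off $0$, so $\{0\}$ is closed, and a topological group with
closed points is Hausdorff. -/
instance : T2Space K := by
  have : IsClosed ({0} : Set K) := by
    rw [← isOpen_compl_iff, isOpen_iff_mem_nhds]
    intro x hx
    have hx' : valuation K x ≠ 0 := by simpa using hx
    refine mem_of_superset (Valuation.locally_const (v := valuation K) hx') fun y hy => ?_
    rintro rfl
    exact hx' (by simpa using hy.symm)
  have := IsTopologicalAddGroup.t1Space K this
  infer_instance

instance : Countable (ValueGroupWithZero K) :=
  have : Countable (WithZero (Multiplicative ℤ)) := inferInstanceAs (Countable (Option ℤ))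
  (IsNonarchimedeanLocalField.valueGroupWithZeroIsoInt K).injective.countable

instance : SigmaCompactSpace K := by
  refine .of_countable (Set.range fun γ : ValueGroupWithZero K => {x : K | valuation K x ≤ γ})
    (Set.countable_range _) ?_ ?_
  · rintro _ ⟨γ, rfl⟩
    exact IsNonarchimedeanLocalField.isCompact_closedBall K γ
  · exact Set.eq_univ_of_forall fun x => ⟨_, ⟨valuation K x, rfl⟩, le_refl (valuation K x)⟩

instance : SecondCountableTopology K := by
  let := IsTopologicalAddGroup.rightUniformSpace K
  have := isUniformAddGroup_of_addCommGroup (G := K)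
  have : (𝓝 (0 : K)).IsCountablyGenerated :=
    (IsValuativeTopology.hasBasis_nhds_zero' K).isCountablyGenerated
  have := IsUniformAddGroup.uniformity_countably_generated (α := K)
  let := UniformSpace.pseudoMetricSpace K
  exact EMetric.secondCountable_of_sigmaCompact K

theorem isOpenEmbedding_val : IsOpenEmbedding (Units.val : Kˣ → K) :=
  IsOpenUnits.isOpenEmbedding_unitsVal

variable (K) in
/-- The ring of integers as a set is clopen. -/
theorem isClopen_integers : IsClopen {x : K | valuation K x ≤ 1} :=
  Valuation.isClopen_integer (v := valuation K)

variable (K) in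
theorem isCompact_integers : IsCompact {x : K | valuation K x ≤ 1} :=
  IsNonarchimedeanLocalField.isCompact_closedBall K 1

variable (K) in
/-- The units of the ring of integers, as a subgroup of `Kˣ`. -/
def unitGroup : Subgroup Kˣ := (ordHom K).ker

theorem mem_unitGroup {x : Kˣ} : x ∈ unitGroup K ↔ ord x = 0 := by
  simp only [unitGroup, MonoidHom.mem_ker, ordHom, MonoidHom.coe_mk, OneHom.coe_mk]
  exact ofAdd_eq_one

theorem isOpen_unitGroup : IsOpen (unitGroup K : Set Kˣ) := by
  refine Subgroup.isOpen_of_mem_nhds (g := 1) _ ?_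
  have h := Valuation.locally_const (v := valuation K) (x := 1) (by simp)
  rw [← Units.val_one (α := K)] at h
  filter_upwards [Units.continuous_val.continuousAt.preimage_mem_nhds h] with x hx
  rw [SetLike.mem_coe, mem_unitGroup, ord_eq_zero_iff]
  simpa using hx

theorem isCompact_unitGroup : IsCompact (unitGroup K : Set Kˣ) := by
  rw [isOpenEmbedding_val.isEmbedding.isCompact_iff]
  have : Units.val '' (unitGroup K : Set Kˣ) = {x : K | valuation K x = 1} := by
    ext x
    constructor
    · rintro ⟨u, hu, rfl⟩
      exact (ord_eq_zero_iff u).1 (mem_unitGroup.1 hu)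
    · intro hx
      have h0 : x ≠ 0 := by rintro rfl; simp at hx
      exact ⟨Units.mk0 x h0, mem_unitGroup.2 ((ord_eq_zero_iff _).2 hx), rfl⟩
  rw [this]
  refine (isCompact_integers K).of_isClosed_subset ?_ fun x hx => le_of_eq hx
  rw [← isOpen_compl_iff, isOpen_iff_mem_nhds]
  intro x hx
  by_cases h0 : valuation K x = 0
  · have : x = 0 := by simpa using h0
    subst this
    refine mem_of_superset ((IsValuativeTopology.hasBasis_nhds_zero' K).mem_of_mem one_ne_zero)
      fun y hy => ?_
    exact ne_of_lt hy
  · refine mem_of_superset (Valuation.locally_const (v := valuation K) h0) fun y hy => ?_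
    simp only [Set.mem_ofPred_eq] at hy
    simpa [hy] using hx

theorem isCompact_of_le_unitGroup {V : Subgroup Kˣ} (hV : IsOpen (V : Set Kˣ))
    (hVU : V ≤ unitGroup K) : IsCompact (V : Set Kˣ) :=
  isCompact_unitGroup.of_isClosed_subset (V.isClosed_of_isOpen hV) hVU

/-- The open subgroups of the group of integral units form a neighbourhood basis at `1`. -/
theorem exists_open_subgroup {W : Set Kˣ} (hW : W ∈ 𝓝 1) :
    ∃ V : Subgroup Kˣ, IsOpen (V : Set Kˣ) ∧ V ≤ unitGroup K ∧ (V : Set Kˣ) ⊆ W := by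
  rw [isOpenEmbedding_val.isInducing.nhds_eq_comap, mem_comap] at hW
  obtain ⟨t, ht, htW⟩ := hW
  obtain ⟨γ, hγ0, hγ⟩ := (IsValuativeTopology.hasBasis_nhds' (((1 : Kˣ) : K))).mem_iff.1 ht
  -- The cap at `1` puts the ball inside the units; valuation $1$ then makes it stable under
  -- products and inverses.
  have hun : ∀ x : Kˣ, valuation K ((x : K) - 1) < min γ 1 → valuation K (x : K) = 1 := by
    intro x hx
    have := (valuation K).map_one_add_of_lt (hx.trans_le (min_le_right _ _))
    simpa using this
  let V : Subgroup Kˣ :=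
    { carrier := {x | valuation K ((x : K) - 1) < min γ 1}
      one_mem' := by simp [zero_lt_iff, hγ0]
      mul_mem' := by
        intro a b ha hb
        have : ((a * b : Kˣ) : K) - 1 = a * (b - 1) + (a - 1) := by push_cast; ring
        simp only [Set.mem_ofPred_eq] at ha hb ⊢
        rw [this]
        refine (valuation K).map_add_lt ?_ ha
        rw [map_mul, hun a ha, one_mul]
        exact hb
      inv_mem' := by
        intro a ha
        have : ((a⁻¹ : Kˣ) : K) - 1 = -(((a⁻¹ : Kˣ) : K) * (a - 1)) := by
          rw [mul_sub, Units.inv_mul]; ring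
        simp only [Set.mem_ofPred_eq] at ha ⊢
        rw [this, Valuation.map_neg, map_mul, Units.val_inv_eq_inv_val, map_inv₀, hun a ha, inv_one,
          one_mul]
        exact ha }
  refine ⟨V, Subgroup.isOpen_of_mem_nhds (g := 1) _ ?_, fun x hx => ?_, fun x hx => htW (hγ ?_)⟩
  · rw [isOpenEmbedding_val.isInducing.nhds_eq_comap]
    refine ⟨_, (IsValuativeTopology.hasBasis_nhds' (((1 : Kˣ) : K))).mem_of_mem
      (i := min γ 1) ?_, fun x hx => ?_⟩
    · intro h
      rcases min_choice γ 1 with h' | h' <;> rw [h'] at h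
      · exact hγ0 h
      · exact one_ne_zero h
    · have hx' : valuation K ((x : K) - 1) < min γ 1 := by simpa using hx
      exact hx'
  · exact mem_unitGroup.2 ((ord_eq_zero_iff x).2 (hun x hx))
  · have : valuation K ((x : K) - 1) < min γ 1 := hx
    simpa using this.trans_le (min_le_left _ _)

/-- A locally constant function of compact support on `Kˣ` is invariant under an open subgroup. -/
theorem exists_invariant_subgroup {f : Kˣ → ℂ} (hf : IsLocallyConstant f)
    (hc : IsCompact (Function.support f)) {W : Set Kˣ} (hW : W ∈ 𝓝 1) :
    ∃ V : Subgroup Kˣ, IsOpen (V : Set Kˣ) ∧ V ≤ unitGroup K ∧ (V : Set Kˣ) ⊆ W ∧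
      ∀ x, ∀ v ∈ V, f (x * v) = f x := by
  have key : ∃ V : Subgroup Kˣ, IsOpen (V : Set Kˣ) ∧ V ≤ unitGroup K ∧ (V : Set Kˣ) ⊆ W ∧
      ∀ x ∈ Function.support f, ∀ v ∈ V, f (x * v) = f x := by
    -- Invariance holds locally on the support; compactness and finite intersections of subgroups
    -- give one $V$ for the whole support.
    refine hc.induction_on (p := fun S => ∃ V : Subgroup Kˣ, IsOpen (V : Set Kˣ) ∧
      V ≤ unitGroup K ∧ (V : Set Kˣ) ⊆ W ∧ ∀ x ∈ S, ∀ v ∈ V, f (x * v) = f x) ?_ ?_ ?_ ?_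
    · obtain ⟨V, h1, h2, h3⟩ := exists_open_subgroup hW
      exact ⟨V, h1, h2, h3, by simp⟩
    · rintro s t hst ⟨V, h1, h2, h3, h4⟩
      exact ⟨V, h1, h2, h3, fun x hx => h4 x (hst hx)⟩
    · rintro s t ⟨V, h1, h2, h3, h4⟩ ⟨V', h1', h2', h3', h4'⟩
      refine ⟨V ⊓ V', h1.inter h1', inf_le_left.trans h2, fun x hx => h3 hx.1, ?_⟩
      rintro x (hx | hx) v hv
      · exact h4 x hx v hv.1
      · exact h4' x hx v hv.2
    · intro x _
      have hx : {v : Kˣ | f (x * v) = f x} ∈ 𝓝 (1 : Kˣ) := by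
        have h := (hf.isOpen_fiber (f x)).preimage (continuous_const_mul x)
        exact h.mem_nhds (by simp)
      obtain ⟨V, h1, h2, h3⟩ := exists_open_subgroup (inter_mem hW hx)
      -- The neighbourhood is the coset $xV$, on which `f` is constant; it contains $yv$ along with
      -- $y$.
      refine ⟨(fun y => x⁻¹ * y) ⁻¹' (V : Set Kˣ), mem_nhdsWithin_of_mem_nhds
        ((h1.preimage (continuous_const_mul x⁻¹)).mem_nhds (by simp)), V, h1, h2,
        fun v hv => (h3 hv).1, ?_⟩
      intro y hy v hv
      have e1 : f (x * (x⁻¹ * y)) = f x := (h3 hy).2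
      have e2 : f (x * (x⁻¹ * y * v)) = f x := (h3 (V.mul_mem hy hv)).2
      rw [← mul_assoc, ← mul_assoc, mul_inv_cancel, one_mul] at e2
      rw [mul_inv_cancel_left] at e1
      rw [e1, e2]
  obtain ⟨V, h1, h2, h3, h4⟩ := key
  refine ⟨V, h1, h2, h3, fun x v hv => ?_⟩
  by_cases hx : f x = 0
  -- Off the support: if `f (x * v) ≠ 0`, invariance at `x * v` under `v⁻¹` gives a contradiction.
  · by_contra hne
    have := h4 (x * v) (by rw [Function.mem_support]; rwa [hx] at hne) v⁻¹ (V.inv_mem hv)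
    rw [mul_inv_cancel_right] at this
    exact hne this.symm
  · exact h4 x hx v hv

end Topology

/-! ### Decomposition of Schwartz–Bruhat functions and equivariant functionals -/

section Decomposition

open Topology Filter

variable {K : Type*} [Field K] [ValuativeRel K] [TopologicalSpace K]
  [IsNonarchimedeanLocalField K]

/-- The characteristic function of a compact open set. -/
def charFun (S : Set K) (ho : IsOpen S) (hc : IsCompact S) : SchwartzBruhat K :=
  ⟨S.indicator 1, by
    classical
    exact (LocallyConstant.charFn ℂ (U := S) ⟨hc.isClosed, ho⟩).isLocallyConstant,
    HasCompactSupport.intro hc fun _ hx => Set.indicator_of_notMem hx _⟩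

variable (K) in
/-- The characteristic function of the ring of integers. -/
def charIntegers : SchwartzBruhat K :=
  charFun _ (isClopen_integers K).isOpen (isCompact_integers K)

/-- The characteristic function of an open subgroup of the group of integral units. -/
def charSubgroup (V : Subgroup Kˣ) (hV : IsOpen (V : Set Kˣ)) (hVU : V ≤ unitGroup K) :
    SchwartzBruhat K :=
  charFun (Units.val '' (V : Set Kˣ)) (isOpenEmbedding_val.isOpenMap _ hV)
    ((isCompact_of_le_unitGroup hV hVU).image Units.continuous_val)

open Classical in
theorem charIntegers_apply (x : K) :
    (charIntegers K : K → ℂ) x = if valuation K x ≤ 1 then 1 else 0 := by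
  simp [charIntegers, charFun, Set.indicator_apply]

open Classical in
theorem charSubgroup_apply (V : Subgroup Kˣ) (hV : IsOpen (V : Set Kˣ)) (hVU : V ≤ unitGroup K)
    (x : Kˣ) : (charSubgroup V hV hVU : K → ℂ) x = if x ∈ V then 1 else 0 := by
  have : (x : K) ∈ Units.val '' (V : Set Kˣ) ↔ x ∈ V :=
    Units.val_injective.mem_set_image
  simp only [charSubgroup, charFun, Set.indicator_apply, this, Pi.one_apply]

theorem charSubgroup_zero (V : Subgroup Kˣ) (hV : IsOpen (V : Set Kˣ)) (hVU : V ≤ unitGroup K) :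
    (charSubgroup V hV hVU : K → ℂ) 0 = 0 := by
  simp [charSubgroup, charFun]

theorem dilate_apply (α : Kˣ) (g : SchwartzBruhat K) (x : K) :
    (dilate α g : K → ℂ) x = (g : K → ℂ) (α * x) := rfl

theorem SchwartzBruhat.ext {f g : SchwartzBruhat K} (h0 : (f : K → ℂ) 0 = (g : K → ℂ) 0)
    (h : ∀ x : Kˣ, (f : K → ℂ) x = (g : K → ℂ) x) : f = g := by
  refine Subtype.ext (funext fun x => ?_)
  by_cases hx : x = 0
  · rw [hx, h0]
  · exact h (Units.mk0 x hx)

/-- This invariance is what makes equivariant functionals vanish at $1_{\mathcal O}$ when $\omega$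
is ramified. -/
theorem dilate_charIntegers {u : Kˣ} (hu : u ∈ unitGroup K) :
    dilate u (charIntegers K) = charIntegers K := by
  refine Subtype.ext (funext fun x => ?_)
  rw [dilate_apply, charIntegers_apply, charIntegers_apply, map_mul,
    (ord_eq_zero_iff u).1 (mem_unitGroup.1 hu), one_mul]

/-- $\mathcal O^\times=\mathcal O\setminus\pi\mathcal O$. This identity is the source of the Euler
factor $1-\omega(\pi)q^{-s}$. -/
theorem charSubgroup_unitGroup :
    charSubgroup (unitGroup K) isOpen_unitGroup le_rfl =
      charIntegers K - dilate (primeElt K)⁻¹ (charIntegers K) := by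
  refine SchwartzBruhat.ext ?_ fun x => ?_
  · rw [charSubgroup_zero]
    simp [dilate_apply]
  · have e : ((charIntegers K - dilate (primeElt K)⁻¹ (charIntegers K) : SchwartzBruhat K) : K → ℂ)
        x = (charIntegers K : K → ℂ) x - (charIntegers K : K → ℂ) (((primeElt K)⁻¹ * x : Kˣ) : K) :=
      rfl
    rw [charSubgroup_apply, e, charIntegers_apply, charIntegers_apply]
    simp only [← ord_nonneg_iff, ord_mul, ord_inv, ord_primeElt, mem_unitGroup]
    split_ifs <;> first | omega | simp

theorem isLocallyConstant_units (g : SchwartzBruhat K) :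
    IsLocallyConstant fun x : Kˣ => (g : K → ℂ) x :=
  g.2.1.comp_continuous Units.continuous_val

/-- By local constancy the support is closed, and vanishing at $0$ keeps it inside $K^\times$. -/
theorem isCompact_support_units (g : SchwartzBruhat K) (h0 : (g : K → ℂ) 0 = 0) :
    IsCompact (Function.support fun x : Kˣ => (g : K → ℂ) x) := by
  rw [isOpenEmbedding_val.isEmbedding.isCompact_iff]
  have : Units.val '' (Function.support fun x : Kˣ => (g : K → ℂ) x) =
      Function.support (g : K → ℂ) := by
    ext x
    constructor
    · rintro ⟨u, hu, rfl⟩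
      exact hu
    · intro hx
      have hx0 : x ≠ 0 := by rintro rfl; exact hx h0
      exact ⟨Units.mk0 x hx0, hx, rfl⟩
  rw [this]
  refine IsCompact.of_isClosed_subset g.2.2 ?_ (subset_tsupport _)
  exact (g.2.1.isClopen_fiber 0).compl.isClosed

/-- A Schwartz-Bruhat function vanishing at `0` and invariant under an open compact subgroup `V` is
a linear combination of dilates of the characteristic function of `V`. -/
theorem exists_eq_sum_dilate (g : SchwartzBruhat K) (h0 : (g : K → ℂ) 0 = 0) {V : Subgroup Kˣ}
    (hV : IsOpen (V : Set Kˣ)) (hVU : V ≤ unitGroup K)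
    (hinv : ∀ x : Kˣ, ∀ v ∈ V, (g : K → ℂ) ((x * v : Kˣ) : K) = (g : K → ℂ) x) :
    ∃ F : Finset Kˣ, g = ∑ a ∈ F, (g : K → ℂ) a • dilate a⁻¹ (charSubgroup V hV hVU) := by
  classical
  -- The quotient by $V$ is discrete, so the compact support meets only finitely many cosets;
  -- `Quotient.out` picks their representatives.
  have hd : DiscreteTopology (Kˣ ⧸ V) := QuotientGroup.discreteTopology hV
  have hfin : ((QuotientGroup.mk : Kˣ → Kˣ ⧸ V) ''
      (Function.support fun x : Kˣ => (g : K → ℂ) x)).Finite :=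
    ((isCompact_support_units g h0).image continuous_quotient_mk').finite_of_discrete
  have hout : ∀ x : Kˣ, (g : K → ℂ) ((Quotient.out (x : Kˣ ⧸ V) : Kˣ) : K) = (g : K → ℂ) x := by
    intro x
    obtain ⟨v, hv⟩ := QuotientGroup.mk_out_eq_mul V x
    rw [hv, hinv x v v.2]
  refine ⟨hfin.toFinset.image Quotient.out, SchwartzBruhat.ext ?_ fun x => ?_⟩
  · rw [h0, Submodule.coe_sum, Finset.sum_apply, Finset.sum_eq_zero]
    intro a _
    simp [dilate_apply, charSubgroup_zero]
  · rw [Submodule.coe_sum, Finset.sum_apply, Finset.sum_image (fun a _ b _ h => Quotient.out_inj.1 h)]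
    -- The dilate by $a^{-1}$ of $1_V$ is the indicator of $aV$, so only the coset of `x`
    -- contributes at `x`.
    have hterm : ∀ c : Kˣ ⧸ V, ((((g : K → ℂ) ((Quotient.out c : Kˣ) : K)) •
        dilate (Quotient.out c)⁻¹ (charSubgroup V hV hVU) : SchwartzBruhat K) : K → ℂ) x =
        if c = (x : Kˣ ⧸ V) then (g : K → ℂ) x else 0 := by
      intro c
      rw [Submodule.coe_smul, Pi.smul_apply, dilate_apply, ← Units.val_mul, charSubgroup_apply,
        ← QuotientGroup.eq, QuotientGroup.out_eq', smul_eq_mul]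
      split_ifs with h
      · rw [h, hout, mul_one]
      · rw [mul_zero]
    refine Eq.symm ((Finset.sum_eq_single (x : Kˣ ⧸ V)
      (fun c _ hc => (hterm c).trans (if_neg hc)) fun h => ?_).trans ((hterm x).trans (if_pos rfl)))
    refine (hterm x).trans ((if_pos rfl).trans ?_)
    by_contra hne
    exact h (hfin.mem_toFinset.2 ⟨x, hne, rfl⟩)

theorem sub_smul_charIntegers_apply_zero (g : SchwartzBruhat K) :
    ((g - (g : K → ℂ) 0 • charIntegers K : SchwartzBruhat K) : K → ℂ) 0 = 0 := by
  have : ((g - (g : K → ℂ) 0 • charIntegers K : SchwartzBruhat K) : K → ℂ) 0 =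
    (g : K → ℂ) 0 - (g : K → ℂ) 0 * (charIntegers K : K → ℂ) 0 := rfl
  rw [this, charIntegers_apply]
  simp

/-- A functional transforming under dilations by a quasi-character trivial on `V₀` is determined by
its values at the characteristic functions of `V₀` and of the ring of integers. -/
theorem eq_zero_of_equivariant (Λ : SchwartzBruhat K →ₗ[ℂ] ℂ) (χ : Kˣ → ℂ)
    (hΛ : ∀ α g, Λ (dilate α g) = χ α * Λ g) {V₀ : Subgroup Kˣ} (hV₀ : IsOpen (V₀ : Set Kˣ))
    (hV₀U : V₀ ≤ unitGroup K) (hχ : ∀ v ∈ V₀, χ v = 1)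
    (h₀ : Λ (charSubgroup V₀ hV₀ hV₀U) = 0) (h₁ : Λ (charIntegers K) = 0) : Λ = 0 := by
  classical
  have main : ∀ g : SchwartzBruhat K, (g : K → ℂ) 0 = 0 → Λ g = 0 := by
    intro g hg
    obtain ⟨V, hV, hVU, hVV₀, hinv⟩ := exists_invariant_subgroup (isLocallyConstant_units g)
      (isCompact_support_units g hg) (hV₀.mem_nhds V₀.one_mem)
    have hV0 : Λ (charSubgroup V hV hVU) = 0 := by
      obtain ⟨F, hF⟩ := exists_eq_sum_dilate (charSubgroup V₀ hV₀ hV₀U) (charSubgroup_zero _ _ _)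
        hV hVU (fun x v hv => by
          rw [charSubgroup_apply, charSubgroup_apply]
          simp only [V₀.mul_mem_cancel_right (hVV₀ hv)])
      -- $1_{V_0}$ is a sum of translates of $1_V$ by elements of $V_0$, where `χ` is trivial; each
      -- contributes the same value of `Λ`.
      have hcard : ((F.filter (· ∈ V₀)).card : ℂ) * Λ (charSubgroup V hV hVU) = 0 := by
        rw [← h₀]
        conv_rhs => rw [hF]
        rw [map_sum, ← nsmul_eq_mul, ← Finset.sum_const, Finset.sum_filter]
        refine Finset.sum_congr rfl fun a _ => ?_
        rw [map_smul, hΛ, charSubgroup_apply, smul_eq_mul]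
        split_ifs with h
        · rw [hχ _ (V₀.inv_mem h)]; ring
        · rw [zero_mul]
      refine (mul_eq_zero.1 hcard).resolve_left fun hz => ?_
      rw [Nat.cast_eq_zero, Finset.card_eq_zero, Finset.filter_eq_empty_iff] at hz
      have : charSubgroup V₀ hV₀ hV₀U = 0 := by
        rw [hF]
        refine Finset.sum_eq_zero fun a ha => ?_
        rw [charSubgroup_apply, if_neg (hz ha), zero_smul]
      have h1 := charSubgroup_apply V₀ hV₀ hV₀U 1
      rw [this, if_pos V₀.one_mem] at h1
      exact zero_ne_one h1
    obtain ⟨F, hF⟩ := exists_eq_sum_dilate g hg hV hVU hinv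
    rw [hF, map_sum]
    refine Finset.sum_eq_zero fun a _ => ?_
    rw [map_smul, hΛ, hV0, mul_zero, smul_zero]
  ext g
  have h := main (g - (g : K → ℂ) 0 • charIntegers K) (sub_smul_charIntegers_apply_zero g)
  rw [map_sub, map_smul, h₁, smul_zero, sub_zero] at h
  simpa using h

end Decomposition

/-! ### The normalised absolute value -/

section AbsoluteValue

open Topology Filter

variable {K : Type*} [Field K] [ValuativeRel K] [TopologicalSpace K]
  [IsNonarchimedeanLocalField K]

variable (K) in
theorem one_lt_residueCard : 1 < residueCard K := Finite.one_lt_card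

variable (K) in
theorem residueCard_pos : (0 : ℝ) < residueCard K := by
  exact_mod_cast (one_lt_residueCard K).le

theorem absVal_pos (x : Kˣ) : 0 < absVal x := zpow_pos (residueCard_pos K) _

theorem absVal_mul (x y : Kˣ) : absVal (x * y) = absVal x * absVal y := by
  rw [absVal, absVal, absVal, ord_mul, ← zpow_add₀ (residueCard_pos K).ne']
  congr 1
  ring

theorem absVal_of_mem {u : Kˣ} (hu : u ∈ unitGroup K) : absVal u = 1 := by
  rw [absVal, mem_unitGroup.1 hu, neg_zero, zpow_zero]

theorem absVal_inv (x : Kˣ) : absVal x⁻¹ = (absVal x)⁻¹ := by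
  rw [absVal, absVal, ord_inv, ← zpow_neg]

theorem absVal_primeElt : absVal (primeElt K) = (residueCard K : ℝ)⁻¹ := by
  rw [absVal, ord_primeElt, zpow_neg_one]

theorem isLocallyConstant_absVal : IsLocallyConstant (absVal : Kˣ → ℝ) := by
  rw [IsLocallyConstant.iff_eventually_eq]
  intro x
  have := (isOpen_unitGroup.preimage (continuous_const_mul x⁻¹)).mem_nhds
    (show x ∈ (fun y => x⁻¹ * y) ⁻¹' (unitGroup K : Set Kˣ) by simp)
  filter_upwards [this] with y hy
  have := absVal_of_mem hy
  rw [absVal_mul, absVal_inv, inv_mul_eq_one₀ (absVal_pos x).ne'] at this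
  exact this.symm

theorem exists_eq_zpow_mul (x : Kˣ) : ∃ u ∈ unitGroup K, x = primeElt K ^ ord x * u := by
  refine ⟨(primeElt K ^ ord x)⁻¹ * x, ?_, by simp⟩
  rw [mem_unitGroup, ord_mul, ord_inv, ord_zpow, ord_primeElt]
  ring

end AbsoluteValue

/-! ### Haar measure under dilation, and the invariant measure on $K^\times$ -/

section HaarMeasure

open Topology Filter
open scoped Pointwise NNReal ENNReal

variable {K : Type*} [Field K] [ValuativeRel K] [TopologicalSpace K]
  [IsNonarchimedeanLocalField K] [MeasurableSpace K] [BorelSpace K]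

instance : BorelSpace Kˣ where
  measurable_eq := by
    rw [isOpenEmbedding_val.isInducing.eq_induced, borel_comap, ← BorelSpace.measurable_eq (α := K)]
    rfl

theorem measurableEmbedding_val : MeasurableEmbedding (Units.val : Kˣ → K) :=
  isOpenEmbedding_val.measurableEmbedding

variable (μ : Measure K) [μ.IsAddHaarMeasure]

theorem measure_integers_pos : 0 < μ {x : K | valuation K x ≤ 1} :=
  (isClopen_integers K).isOpen.measure_pos μ ⟨0, by simp⟩

theorem measure_integers_lt_top : μ {x : K | valuation K x ≤ 1} < ∞ :=
  (isCompact_integers K).measure_lt_top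

/-- Multiplication by a prime shrinks the ring of integers by the factor `q`. -/
theorem residueCard_mul_measure_prime_smul :
    (residueCard K : ℝ≥0∞) * μ (primeElt K • {x : K | valuation K x ≤ 1}) =
      μ {x : K | valuation K x ≤ 1} := by
  -- Restricted to $\mathcal O$ the measure is still translation invariant, and $\pi\mathcal O$ is
  -- the maximal ideal, of index $q$ in $\mathcal O$.
  have hemb : MeasurableEmbedding (Subtype.val : 𝒪[K] → K) :=
    .subtype_coe (isClopen_integers K).isOpen.measurableSet
  have hinv : (μ.comap (Subtype.val : 𝒪[K] → K)).IsAddLeftInvariant :=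
    Measure.IsAddLeftInvariant.comap μ (f := (𝒪[K].subtype : 𝒪[K] →+ K)) hemb
  have hrange : Subtype.val '' (Set.univ : Set 𝒪[K]) = {x : K | valuation K x ≤ 1} := by
    rw [Set.image_univ, Subtype.range_val]; rfl
  have hmax : Subtype.val '' ((𝓂[K]).toAddSubgroup : Set 𝒪[K]) =
      primeElt K • {x : K | valuation K x ≤ 1} := by
    ext x
    rw [Set.mem_smul_set_iff_inv_smul_mem]
    have key : valuation K x < 1 ↔ (primeElt K)⁻¹ • x ∈ {x : K | valuation K x ≤ 1} := by
      by_cases hx : x = 0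
      · subst hx
        simp
      · have h1 := ord_nonneg_iff (Units.mk0 x hx)
        have h2 := ord_eq_zero_iff (Units.mk0 x hx)
        have h3 := ord_nonneg_iff ((primeElt K)⁻¹ * Units.mk0 x hx)
        rw [ord_mul, ord_inv, ord_primeElt, Units.val_mul] at h3
        rw [Units.val_mk0] at h1 h2 h3
        rw [Units.smul_def, smul_eq_mul, Set.mem_ofPred_eq, ← h3, lt_iff_le_and_ne, ne_eq, ← h1,
          ← h2]
        omega
    rw [← key]
    constructor
    · rintro ⟨y, hy, rfl⟩
      exact Valuation.Integer.not_isUnit_iff_valuation_lt_one.1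
        ((IsLocalRing.mem_maximalIdeal y).1 hy)
    · intro hx
      refine ⟨⟨x, hx.le⟩, ?_, rfl⟩
      exact (IsLocalRing.mem_maximalIdeal _).2
        (Valuation.Integer.not_isUnit_iff_valuation_lt_one.2 hx)
  have hmeas : MeasurableSet ((𝓂[K]).toAddSubgroup : Set 𝒪[K]) := by
    rw [← hemb.measurableSet_image, hmax]
    exact (isClopen_integers K).isOpen.measurableSet.const_smul _
  have hindex : (𝓂[K]).toAddSubgroup.index = residueCard K := rfl
  have : (𝓂[K]).toAddSubgroup.FiniteIndex :=
    ⟨by rw [hindex]; exact (zero_lt_one.trans (one_lt_residueCard K)).ne'⟩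
  have := AddSubgroup.index_mul_measure (𝓂[K]).toAddSubgroup hmeas
    (μ.comap (Subtype.val : 𝒪[K] → K))
  rwa [hemb.comap_apply, hemb.comap_apply, hrange, hmax, hindex] at this

/-- Both sides are multiplicative, so units (which preserve $\mathcal O$) and one prime (which
shrinks it by $q$) suffice. -/
theorem distribHaarChar_eq_absVal (α : Kˣ) : (distribHaarChar K α : ℝ) = absVal α := by
  let μ : Measure K := Measure.addHaar
  have hu : ∀ u ∈ unitGroup K, distribHaarChar K u = 1 := by
    intro u hu
    refine distribHaarChar_eq_of_measure_smul_eq_mul (μ := μ) (measure_integers_pos μ).ne'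
      (measure_integers_lt_top μ).ne ?_
    rw [ENNReal.coe_one, one_mul]
    congr 1
    ext x
    rw [Set.mem_smul_set_iff_inv_smul_mem]
    simp only [Set.mem_ofPred_eq, Units.smul_def, smul_eq_mul, map_mul,
      (ord_eq_zero_iff u⁻¹).1 (mem_unitGroup.1 (inv_mem hu)), one_mul]
  have hp : distribHaarChar K (primeElt K) = (residueCard K : ℝ≥0)⁻¹ := by
    have hq : (residueCard K : ℝ≥0) ≠ 0 := by
      exact_mod_cast (zero_lt_one.trans (one_lt_residueCard K)).ne'
    refine distribHaarChar_eq_of_measure_smul_eq_mul (μ := μ) (measure_integers_pos μ).ne'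
      (measure_integers_lt_top μ).ne ?_
    rw [← residueCard_mul_measure_prime_smul μ, ← mul_assoc, ENNReal.coe_inv hq,
      ENNReal.coe_natCast, ENNReal.inv_mul_cancel, one_mul]
    · exact_mod_cast hq
    · exact ENNReal.natCast_ne_top _
  obtain ⟨u, hu', hα⟩ := exists_eq_zpow_mul α
  conv_lhs => rw [hα]
  rw [map_mul, map_zpow, hp, hu u hu', mul_one, absVal]
  simp

theorem measure_units_smul (α : Kˣ) (s : Set K) :
    μ (α • s) = ENNReal.ofReal (absVal α) * μ s := by
  rw [← distribHaarChar_mul μ, ← distribHaarChar_eq_absVal, ENNReal.ofReal_coe_nnreal]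

theorem measurable_absVal : Measurable (absVal : Kˣ → ℝ) :=
  isLocallyConstant_absVal.continuous.measurable

theorem map_mul_left_comap (α : Kˣ) :
    (μ.comap (Units.val : Kˣ → K)).map (α * ·) =
      ENNReal.ofReal (absVal α)⁻¹ • μ.comap (Units.val : Kˣ → K) := by
  ext s hs
  rw [Measure.map_apply (continuous_const_mul α).measurable hs, Measure.smul_apply,
    measurableEmbedding_val.comap_apply, measurableEmbedding_val.comap_apply, smul_eq_mul,
    ← absVal_inv, ← measure_units_smul]
  congr 1
  ext x
  rw [Set.mem_smul_set_iff_inv_smul_mem, inv_inv]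
  constructor
  · rintro ⟨u, hu, rfl⟩
    exact ⟨α * u, hu, by simp [Units.smul_def]⟩
  · rintro ⟨u, hu, h⟩
    refine ⟨α⁻¹ * u, by simpa using hu, ?_⟩
    rw [Units.val_mul, h, Units.smul_def, smul_eq_mul, Units.inv_mul_cancel_left]

/-- The measure `|x|⁻¹ dx` on `Kˣ` is invariant under multiplication. -/
theorem measurePreserving_mul_left (α : Kˣ) :
    MeasurePreserving (α * ·) (mulMeasure μ) (mulMeasure μ) := by
  refine ⟨(continuous_const_mul α).measurable, ?_⟩
  have hdens : Measurable fun x : Kˣ => ENNReal.ofReal (absVal x)⁻¹ :=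
    measurable_absVal.inv.ennreal_ofReal
  have hm : Measurable fun x : Kˣ => α * x := (continuous_const_mul α).measurable
  ext s hs
  rw [Measure.map_apply hm hs, mulMeasure,
    withDensity_apply _ (hm hs), withDensity_apply _ hs, ← lintegral_indicator (hm hs),
    ← lintegral_indicator hs]
  -- The density at $x$ is $|\alpha|$ times the density at $\alpha x$, which cancels the
  -- $|\alpha|^{-1}$ of `map_mul_left_comap`.
  have e : ∀ x : Kˣ, ((fun x => α * x) ⁻¹' s).indicator (fun x => ENNReal.ofReal (absVal x)⁻¹) x =
      (fun y => ENNReal.ofReal (absVal α) *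
        s.indicator (fun x => ENNReal.ofReal (absVal x)⁻¹) y) (α * x) := by
    intro x
    by_cases hx : α * x ∈ s
    · rw [Set.indicator_of_mem (by exact hx)]
      dsimp only
      rw [Set.indicator_of_mem hx,
        ← ENNReal.ofReal_mul (absVal_pos α).le, absVal_mul, mul_inv,
        mul_inv_cancel_left₀ (absVal_pos α).ne']
    · rw [Set.indicator_of_notMem (by exact hx)]
      dsimp only
      rw [Set.indicator_of_notMem hx, mul_zero]
  simp_rw [e]
  rw [← lintegral_map (μ := μ.comap Units.val) ((hdens.indicator hs).const_mul _) hm,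
    map_mul_left_comap, lintegral_smul_measure, lintegral_const_mul _ (hdens.indicator hs),
    smul_eq_mul, ← mul_assoc, ← ENNReal.ofReal_mul (inv_nonneg.2 (absVal_pos α).le),
    inv_mul_cancel₀ (absVal_pos α).ne', ENNReal.ofReal_one, one_mul]

theorem integral_comp_mul_left (α : Kˣ) (f : Kˣ → ℂ) :
    ∫ x, f (α * x) ∂(mulMeasure μ) = ∫ x, f x ∂(mulMeasure μ) :=
  (measurePreserving_mul_left μ α).integral_comp'
    (f := (Homeomorph.mulLeft α).toMeasurableEquiv) f

theorem mulMeasure_subgroup {V : Subgroup Kˣ} (hV : IsOpen (V : Set Kˣ))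
    (hVU : V ≤ unitGroup K) : mulMeasure μ (V : Set Kˣ) = μ (Units.val '' (V : Set Kˣ)) := by
  rw [mulMeasure, withDensity_apply _ hV.measurableSet, ← measurableEmbedding_val.comap_apply,
    ← setLIntegral_one]
  refine setLIntegral_congr_fun hV.measurableSet fun x hx => ?_
  rw [absVal_of_mem (hVU hx), inv_one, ENNReal.ofReal_one]

theorem mulMeasure_subgroup_pos {V : Subgroup Kˣ} (hV : IsOpen (V : Set Kˣ))
    (hVU : V ≤ unitGroup K) : 0 < mulMeasure μ (V : Set Kˣ) := by
  rw [mulMeasure_subgroup μ hV hVU]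
  exact (isOpenEmbedding_val.isOpenMap _ hV).measure_pos μ ⟨_, 1, V.one_mem, rfl⟩

theorem mulMeasure_subgroup_lt_top {V : Subgroup Kˣ} (hV : IsOpen (V : Set Kˣ))
    (hVU : V ≤ unitGroup K) : mulMeasure μ (V : Set Kˣ) < ∞ := by
  rw [mulMeasure_subgroup μ hV hVU]
  exact ((isCompact_of_le_unitGroup hV hVU).image Units.continuous_val).measure_lt_top

theorem measureReal_subgroup_pos {V : Subgroup Kˣ} (hV : IsOpen (V : Set Kˣ))
    (hVU : V ≤ unitGroup K) : 0 < (mulMeasure μ).real (V : Set Kˣ) :=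
  ENNReal.toReal_pos (mulMeasure_subgroup_pos μ hV hVU).ne' (mulMeasure_subgroup_lt_top μ hV hVU).ne

/-- A quasi-character is trivial on some open subgroup. -/
theorem exists_open_subgroup_trivial (ω : Kˣ →ₜ* ℂˣ) :
    ∃ V : Subgroup Kˣ, IsOpen (V : Set Kˣ) ∧ V ≤ unitGroup K ∧ ∀ v ∈ V, ω v = 1 := by
  let μ : Measure K := Measure.addHaar
  have hcont : Continuous fun x : Kˣ => (ω x : ℂ) :=
    Units.continuous_val.comp ω.continuous_toFun
  have hW : {x : Kˣ | ‖(ω x : ℂ) - 1‖ < 1 / 2} ∈ 𝓝 (1 : Kˣ) := by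
    refine ((hcont.sub continuous_const).norm.isOpen_preimage _ isOpen_Iio).mem_nhds ?_
    simp
  obtain ⟨V, hV, hVU, hVW⟩ := exists_open_subgroup hW
  refine ⟨V, hV, hVU, fun v hv => ?_⟩
  have hpos := measureReal_subgroup_pos μ hV hVU
  have hint : IntegrableOn (fun x => (ω x : ℂ)) V (mulMeasure μ) := by
    refine Measure.integrableOn_of_bounded (M := 2) (mulMeasure_subgroup_lt_top μ hV hVU).ne
      hcont.measurable.aestronglyMeasurable ?_
    refine (ae_restrict_iff' hV.measurableSet).2 (.of_forall fun x hx => ?_)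
    have h1 : ‖(ω x : ℂ) - 1‖ < 1 / 2 := hVW hx
    have h2 := norm_add_le ((ω x : ℂ) - 1) 1
    rw [sub_add_cancel, norm_one] at h2
    linarith
  -- As $\omega$ stays within $1/2$ of $1$ on $V$, `c` lies within half of $\mathrm{vol}(V)$ of
  -- $\mathrm{vol}(V)$, hence is nonzero. Invariance of the measure gives $c=\omega(v)c$, so
  -- $\omega(v)=1$.
  set c : ℂ := ∫ x in V, (ω x : ℂ) ∂(mulMeasure μ) with hc
  have hc0 : c ≠ 0 := by
    intro h0
    have h1 : ‖∫ x in V, ((ω x : ℂ) - 1) ∂(mulMeasure μ)‖ ≤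
        1 / 2 * (mulMeasure μ).real (V : Set Kˣ) :=
      norm_setIntegral_le_of_norm_le_const (mulMeasure_subgroup_lt_top μ hV hVU)
        fun x hx => le_of_lt (hVW hx)
    rw [integral_sub hint (integrableOn_const (mulMeasure_subgroup_lt_top μ hV hVU).ne), ← hc, h0,
      setIntegral_const, zero_sub, norm_neg, norm_smul, norm_one, mul_one, Real.norm_eq_abs,
      abs_of_pos hpos] at h1
    linarith
  have hinv : c = ω v * c := by
    have h := integral_comp_mul_left μ v ((V : Set Kˣ).indicator fun x => (ω x : ℂ))
    have e : ∀ x, (V : Set Kˣ).indicator (fun x => (ω x : ℂ)) (v * x) =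
        ω v * (V : Set Kˣ).indicator (fun x => (ω x : ℂ)) x := by
      intro x
      have hiff : v * x ∈ (V : Set Kˣ) ↔ x ∈ (V : Set Kˣ) := V.mul_mem_cancel_left hv
      by_cases hx : x ∈ (V : Set Kˣ)
      · rw [Set.indicator_of_mem hx, Set.indicator_of_mem (hiff.2 hx), map_mul, Units.val_mul]
      · rw [Set.indicator_of_notMem hx, Set.indicator_of_notMem (mt hiff.1 hx), mul_zero]
    simp_rw [e] at h
    rw [integral_const_mul, integral_indicator hV.measurableSet] at h
    exact h.symm
  have : (ω v : ℂ) = 1 := mul_right_cancel₀ hc0 (by rw [← hinv, one_mul])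
  exact Units.ext this

end HaarMeasure

/-! ### Zeta integrals: equivariance and convergence -/

section Zeta

open Topology Filter
open scoped ENNReal

variable {K : Type*} [Field K] [ValuativeRel K] [TopologicalSpace K]
  [IsNonarchimedeanLocalField K]

/-- The inverse of the quasi-character `ω |·|ˢ`, by which zeta integrals transform under
dilations. -/
def twist (ω : Kˣ →ₜ* ℂˣ) (s : ℂ) (α : Kˣ) : ℂ := (ω α : ℂ)⁻¹ * (absVal α : ℂ) ^ (-s)

theorem absVal_ne_zero (x : Kˣ) : (absVal x : ℂ) ≠ 0 := by
  exact_mod_cast (absVal_pos x).ne'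

theorem twist_of_mem (ω : Kˣ →ₜ* ℂˣ) (s : ℂ) {u : Kˣ} (hu : u ∈ unitGroup K) :
    twist ω s u = (ω u : ℂ)⁻¹ := by
  rw [twist, absVal_of_mem hu, Complex.ofReal_one, Complex.one_cpow, mul_one]

theorem differentiable_twist (ω : Kˣ →ₜ* ℂˣ) (α : Kˣ) :
    Differentiable ℂ fun s => twist ω s α := by
  intro s
  exact (differentiableAt_id.neg.const_cpow (Or.inl (absVal_ne_zero α))).const_mul _

theorem twist_primeElt_inv (ω : Kˣ →ₜ* ℂˣ) (s : ℂ) :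
    twist ω s (primeElt K)⁻¹ = ω (primeElt K) * (residueCard K : ℂ) ^ (-s) := by
  rw [twist, absVal_inv, absVal_primeElt, inv_inv, map_inv, Units.val_inv_eq_inv_val, inv_inv,
    Complex.ofReal_natCast]

theorem continuous_quasiCharacter (ω : Kˣ →ₜ* ℂˣ) : Continuous fun x => (ω x : ℂ) :=
  Units.continuous_val.comp ω.continuous_toFun

theorem continuous_zetaIntegrand (g : SchwartzBruhat K) (ω : Kˣ →ₜ* ℂˣ) (s : ℂ) :
    Continuous (zetaIntegrand g ω s) :=
  ((isLocallyConstant_units g).continuous.mul (continuous_quasiCharacter ω)).mul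
    (isLocallyConstant_absVal.comp fun t : ℝ => (t : ℂ) ^ s).continuous

theorem zetaIntegrand_add (g h : SchwartzBruhat K) (ω : Kˣ →ₜ* ℂˣ) (s : ℂ) :
    zetaIntegrand (g + h) ω s = zetaIntegrand g ω s + zetaIntegrand h ω s := by
  funext x
  simp only [zetaIntegrand, Submodule.coe_add, Pi.add_apply]
  ring

theorem zetaIntegrand_smul (c : ℂ) (g : SchwartzBruhat K) (ω : Kˣ →ₜ* ℂˣ) (s : ℂ) :
    zetaIntegrand (c • g) ω s = c • zetaIntegrand g ω s := by
  funext x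
  simp only [zetaIntegrand, Submodule.coe_smul, Pi.smul_apply, smul_eq_mul]
  ring

theorem zetaIntegrand_dilate (α : Kˣ) (g : SchwartzBruhat K) (ω : Kˣ →ₜ* ℂˣ) (s : ℂ) (x : Kˣ) :
    zetaIntegrand (dilate α g) ω s x = twist ω s α * zetaIntegrand g ω s (α * x) := by
  have h1 : (ω α : ℂ) ≠ 0 := (ω α).ne_zero
  have h2 : (absVal α : ℂ) ^ s ≠ 0 := by simp [Complex.cpow_eq_zero_iff, (absVal_pos α).ne']
  rw [zetaIntegrand, zetaIntegrand, twist, dilate_apply, absVal_mul, map_mul, Units.val_mul,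
    Units.val_mul, Complex.ofReal_mul,
    Complex.mul_cpow_ofReal_nonneg (absVal_pos α).le (absVal_pos x).le, Complex.cpow_neg]
  field_simp

theorem zetaIntegrand_charSubgroup {V : Subgroup Kˣ} (hV : IsOpen (V : Set Kˣ))
    (hVU : V ≤ unitGroup K) {ω : Kˣ →ₜ* ℂˣ} (hω : ∀ v ∈ V, ω v = 1) (s : ℂ) :
    zetaIntegrand (charSubgroup V hV hVU) ω s = (V : Set Kˣ).indicator fun _ => 1 := by
  funext x
  rw [zetaIntegrand, charSubgroup_apply]
  by_cases hx : x ∈ V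
  · rw [if_pos hx, Set.indicator_of_mem (by exact hx), hω x hx, absVal_of_mem (hVU hx)]
    simp
  · rw [if_neg hx, Set.indicator_of_notMem (by exact hx)]
    simp

/-- In a right half plane, `ω |·|ˢ` is dominated by `|·|` on the ring of integers. -/
theorem exists_norm_quasiCharacter_le (ω : Kˣ →ₜ* ℂˣ) :
    ∃ C σ : ℝ, 0 ≤ C ∧ ∀ s : ℂ, σ < s.re → ∀ x : Kˣ, 0 ≤ ord x →
      ‖(ω x : ℂ) * (absVal x : ℂ) ^ s‖ ≤ C * absVal x := by
  obtain ⟨C, hC⟩ := (isCompact_unitGroup (K := K)).exists_bound_of_continuousOn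
    (continuous_quasiCharacter ω).continuousOn
  have hC0 : 0 ≤ C := (norm_nonneg _).trans (hC 1 (one_mem _))
  have hq := residueCard_pos K
  have hq1 : (1 : ℝ) < residueCard K := by exact_mod_cast one_lt_residueCard K
  set A : ℝ := ‖(ω (primeElt K) : ℂ)‖ with hA
  have hA0 : 0 < A := norm_pos_iff.2 (ω (primeElt K)).ne_zero
  -- This abscissa is where $|\omega(\pi)|q^{-\mathrm{Re}\,s}\le q^{-1}$ begins to hold; `C` bounds
  -- $\omega$ on the compact unit group.
  refine ⟨C, 1 + Real.logb (residueCard K) A, hC0, fun s hs x hx => ?_⟩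
  obtain ⟨u, hu, hxu⟩ := exists_eq_zpow_mul x
  obtain ⟨k, hk⟩ := Int.eq_ofNat_of_zero_le hx
  have hωx : ‖(ω x : ℂ)‖ = A ^ k * ‖(ω u : ℂ)‖ := by
    conv_lhs => rw [hxu, hk]
    rw [map_mul, map_zpow, zpow_natCast, Units.val_mul, Units.val_pow_eq_pow_val, norm_mul,
      norm_pow]
  have habs : absVal x = ((residueCard K : ℝ)⁻¹) ^ k := by
    rw [absVal, hk, zpow_neg, zpow_natCast, inv_pow]
  have hle : A * ((residueCard K : ℝ)⁻¹) ^ s.re ≤ (residueCard K : ℝ)⁻¹ := by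
    have h1 : A ≤ (residueCard K : ℝ) ^ (s.re - 1) := by
      rw [← Real.logb_le_iff_le_rpow hq1 hA0]
      linarith
    rw [Real.inv_rpow hq.le, ← Real.rpow_neg hq.le]
    calc A * (residueCard K : ℝ) ^ (-s.re)
        ≤ (residueCard K : ℝ) ^ (s.re - 1) * (residueCard K : ℝ) ^ (-s.re) := by gcongr
      _ = (residueCard K : ℝ)⁻¹ := by
        rw [← Real.rpow_add hq, ← Real.rpow_neg_one]
        congr 1
        ring
  rw [norm_mul, Complex.norm_cpow_eq_rpow_re_of_pos (absVal_pos x), hωx, habs,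
    ← Real.rpow_natCast_mul (inv_nonneg.2 hq.le), mul_comm (k : ℝ),
    Real.rpow_mul_natCast (inv_nonneg.2 hq.le)]
  calc A ^ k * ‖(ω u : ℂ)‖ * (((residueCard K : ℝ)⁻¹) ^ s.re) ^ k
      = ‖(ω u : ℂ)‖ * (A * ((residueCard K : ℝ)⁻¹) ^ s.re) ^ k := by rw [mul_pow]; ring
    _ ≤ C * ((residueCard K : ℝ)⁻¹) ^ k := by
      gcongr
      exact hC u hu

variable [MeasurableSpace K] (μ : Measure K)

theorem zetaIntegral_add {g h : SchwartzBruhat K} {ω : Kˣ →ₜ* ℂˣ} {s : ℂ}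
    (hg : Integrable (zetaIntegrand g ω s) (mulMeasure μ))
    (hh : Integrable (zetaIntegrand h ω s) (mulMeasure μ)) :
    zetaIntegral μ (g + h) ω s = zetaIntegral μ g ω s + zetaIntegral μ h ω s := by
  rw [zetaIntegral, zetaIntegrand_add]
  exact integral_add hg hh

theorem zetaIntegral_smul (c : ℂ) (g : SchwartzBruhat K) (ω : Kˣ →ₜ* ℂˣ) (s : ℂ) :
    zetaIntegral μ (c • g) ω s = c * zetaIntegral μ g ω s := by
  rw [zetaIntegral, zetaIntegrand_smul]
  exact integral_smul c _

variable [BorelSpace K] [μ.IsAddHaarMeasure]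

theorem integrable_zetaIntegrand_dilate {α : Kˣ} {g : SchwartzBruhat K} {ω : Kˣ →ₜ* ℂˣ} {s : ℂ}
    (h : Integrable (zetaIntegrand g ω s) (mulMeasure μ)) :
    Integrable (zetaIntegrand (dilate α g) ω s) (mulMeasure μ) := by
  have := ((measurePreserving_mul_left μ α).integrable_comp h.aestronglyMeasurable).2 h
  exact (this.const_mul (twist ω s α)).congr
    (.of_forall fun x => (zetaIntegrand_dilate α g ω s x).symm)

theorem zetaIntegral_dilate (α : Kˣ) (g : SchwartzBruhat K) (ω : Kˣ →ₜ* ℂˣ) (s : ℂ) :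
    zetaIntegral μ (dilate α g) ω s = twist ω s α * zetaIntegral μ g ω s := by
  simp only [zetaIntegral, zetaIntegrand_dilate]
  rw [integral_const_mul, integral_comp_mul_left]

theorem integrable_zetaIntegrand_charSubgroup {V : Subgroup Kˣ} (hV : IsOpen (V : Set Kˣ))
    (hVU : V ≤ unitGroup K) {ω : Kˣ →ₜ* ℂˣ} (hω : ∀ v ∈ V, ω v = 1) (s : ℂ) :
    Integrable (zetaIntegrand (charSubgroup V hV hVU) ω s) (mulMeasure μ) := by
  rw [zetaIntegrand_charSubgroup hV hVU hω, integrable_indicator_iff hV.measurableSet]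
  exact integrableOn_const (mulMeasure_subgroup_lt_top μ hV hVU).ne

theorem zetaIntegral_charSubgroup {V : Subgroup Kˣ} (hV : IsOpen (V : Set Kˣ))
    (hVU : V ≤ unitGroup K) {ω : Kˣ →ₜ* ℂˣ} (hω : ∀ v ∈ V, ω v = 1) (s : ℂ) :
    zetaIntegral μ (charSubgroup V hV hVU) ω s = ((mulMeasure μ).real (V : Set Kˣ) : ℂ) := by
  rw [zetaIntegral, zetaIntegrand_charSubgroup hV hVU hω, integral_indicator hV.measurableSet,
    setIntegral_const]
  simp

/-- The domination by $C|x|$ cancels the density $|x|^{-1}$, leaving a bounded function on $\mathcal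
O$, a set of finite measure. -/
theorem exists_integrable_charIntegers (ω : Kˣ →ₜ* ℂˣ) :
    ∃ σ : ℝ, ∀ s : ℂ, σ < s.re →
      Integrable (zetaIntegrand (charIntegers K) ω s) (mulMeasure μ) := by
  obtain ⟨C, σ, hC, h⟩ := exists_norm_quasiCharacter_le ω
  refine ⟨σ, fun s hs => ?_⟩
  have hdens : Measurable fun x : Kˣ => ENNReal.ofReal (absVal x)⁻¹ :=
    measurable_absVal.inv.ennreal_ofReal
  rw [mulMeasure, integrable_withDensity_iff_integrable_smul' hdens
    (.of_forall fun x => ENNReal.ofReal_lt_top)]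
  have hmeas : MeasurableSet {x : Kˣ | valuation K (x : K) ≤ 1} :=
    ((isClopen_integers K).isOpen.preimage Units.continuous_val).measurableSet
  have hfin : μ.comap (Units.val : Kˣ → K) {x : Kˣ | valuation K (x : K) ≤ 1} ≠ ∞ := by
    rw [measurableEmbedding_val.comap_apply]
    refine ((measure_mono ?_).trans_lt (measure_integers_lt_top μ)).ne
    rintro _ ⟨x, hx, rfl⟩
    exact hx
  refine Integrable.mono' (g := {x : Kˣ | valuation K (x : K) ≤ 1}.indicator fun _ => C)
    ((integrable_indicator_iff hmeas).2 (integrableOn_const hfin)) ?_ (.of_forall fun x => ?_)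
  · exact (hdens.ennreal_toReal.smul
      (continuous_zetaIntegrand _ ω s).measurable).aestronglyMeasurable
  · rw [ENNReal.toReal_ofReal (inv_nonneg.2 (absVal_pos x).le), norm_smul, Real.norm_eq_abs,
      abs_of_pos (inv_pos.2 (absVal_pos x)), zetaIntegrand, charIntegers_apply]
    by_cases hx : valuation K (x : K) ≤ 1
    · rw [if_pos hx, Set.indicator_of_mem (by exact hx), one_mul,
        inv_mul_le_iff₀ (absVal_pos x), mul_comm (absVal x)]
      exact h s hs x ((ord_nonneg_iff x).2 hx)
    · rw [if_neg hx, Set.indicator_of_notMem (by exact hx)]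
      simp

end Zeta

/-! ### Entire continuation and proportionality of functionals -/

section Continuation

open Topology Filter

variable {K : Type*} [Field K] [ValuativeRel K] [TopologicalSpace K]
  [IsNonarchimedeanLocalField K]

/-- At a pole `localL` takes the value `0`, whose inverse `0` is the correct value of
$1-\omega(\pi)q^{-s}$. -/
theorem differentiable_localL_inv (ω : Kˣ →ₜ* ℂˣ) : Differentiable ℂ fun s => (localL ω s)⁻¹ := by
  have hq : (residueCard K : ℂ) ≠ 0 := by exact_mod_cast (residueCard_pos K).ne'
  by_cases h : IsUnramified ω
  · simp only [localL, if_pos h, inv_inv]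
    intro s
    exact ((differentiableAt_id.neg.const_cpow (Or.inl hq)).const_mul _).const_sub _
  · simp only [localL, if_neg h]
    exact differentiable_const _

/-- On units the twist is $\omega^{-1}$, free of `s`, so one `u` serves for all `s`. -/
theorem exists_twist_ne_one {ω : Kˣ →ₜ* ℂˣ} (hω : ¬ IsUnramified ω) :
    ∃ u ∈ unitGroup K, ∀ s, twist ω s u ≠ 1 := by
  simp only [IsUnramified, not_forall] at hω
  obtain ⟨u, hu, hne⟩ := hω
  refine ⟨u, mem_unitGroup.2 hu, fun s h => hne (Units.ext ?_)⟩
  rw [twist_of_mem ω s (mem_unitGroup.2 hu)] at h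
  exact inv_eq_one.1 h

theorem eq_zero_of_eq_mul_self {a b : ℂ} (ha : a ≠ 1) (h : b = a * b) : b = 0 := by
  have : (1 - a) * b = 0 := by linear_combination h
  exact (mul_eq_zero.1 this).resolve_left (sub_ne_zero.2 ha.symm)

variable [MeasurableSpace K]

theorem IsEntireContinuation.unique {μ : Measure K} {g : SchwartzBruhat K} {ω : Kˣ →ₜ* ℂˣ}
    {F G : ℂ → ℂ} (hF : IsEntireContinuation μ g ω F) (hG : IsEntireContinuation μ g ω G) :
    F = G := by
  obtain ⟨hFd, σ, hσ⟩ := hF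
  obtain ⟨hGd, τ, hτ⟩ := hG
  refine AnalyticOnNhd.eq_of_eventuallyEq (𝕜 := ℂ) (z₀ := ((max σ τ + 1 : ℝ) : ℂ))
    (fun z _ => hFd.analyticAt z) (fun z _ => hGd.analyticAt z) ?_
  have hopen : IsOpen {s : ℂ | max σ τ < s.re} := isOpen_Ioi.preimage Complex.continuous_re
  filter_upwards [hopen.mem_nhds (show ((max σ τ + 1 : ℝ) : ℂ) ∈ {s : ℂ | max σ τ < s.re} by
    simp only [Set.mem_ofPred_eq, Complex.ofReal_re]; linarith)] with s hs
  rw [(hσ s ((le_max_left _ _).trans_lt hs)).2, (hτ s ((le_max_right _ _).trans_lt hs)).2]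

/-- Through this any explicit continuation may stand for the chosen one in `Z`. -/
theorem IsEntireContinuation.Z_eq {μ : Measure K} {g : SchwartzBruhat K} {ω : Kˣ →ₜ* ℂˣ}
    {F : ℂ → ℂ} (hF : IsEntireContinuation μ g ω F) : Z μ g ω = F := by
  have h : ∃ F : ℂ → ℂ, IsEntireContinuation μ g ω F := ⟨F, hF⟩
  rw [Z, dif_pos h]
  exact h.choose_spec.unique hF

theorem IsEntireContinuation.add {μ : Measure K} {g h : SchwartzBruhat K} {ω : Kˣ →ₜ* ℂˣ}
    {F G : ℂ → ℂ} (hF : IsEntireContinuation μ g ω F) (hG : IsEntireContinuation μ h ω G) :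
    IsEntireContinuation μ (g + h) ω (F + G) := by
  obtain ⟨hFd, σ, hσ⟩ := hF
  obtain ⟨hGd, τ, hτ⟩ := hG
  refine ⟨hFd.add hGd, max σ τ, fun s hs => ?_⟩
  obtain ⟨h1, h2⟩ := hσ s ((le_max_left _ _).trans_lt hs)
  obtain ⟨h3, h4⟩ := hτ s ((le_max_right _ _).trans_lt hs)
  refine ⟨by rw [zetaIntegrand_add]; exact h1.add h3, ?_⟩
  rw [zetaIntegral_add μ h1 h3, Pi.add_apply, h2, h4, add_div]

theorem IsEntireContinuation.smul {μ : Measure K} {g : SchwartzBruhat K} {ω : Kˣ →ₜ* ℂˣ}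
    {F : ℂ → ℂ} (c : ℂ) (hF : IsEntireContinuation μ g ω F) :
    IsEntireContinuation μ (c • g) ω (c • F) := by
  obtain ⟨hFd, σ, hσ⟩ := hF
  refine ⟨hFd.const_smul c, σ, fun s hs => ?_⟩
  obtain ⟨h1, h2⟩ := hσ s hs
  refine ⟨by rw [zetaIntegrand_smul]; exact h1.smul c, ?_⟩
  rw [zetaIntegral_smul, Pi.smul_apply, h2, smul_eq_mul, mul_div_assoc]

variable [BorelSpace K] (μ : Measure K) [μ.IsAddHaarMeasure]

variable {μ} in
theorem IsEntireContinuation.dilate {g : SchwartzBruhat K} {ω : Kˣ →ₜ* ℂˣ}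
    {F : ℂ → ℂ} (α : Kˣ) (hF : IsEntireContinuation μ g ω F) :
    IsEntireContinuation μ (dilate α g) ω fun s => twist ω s α * F s := by
  obtain ⟨hFd, σ, hσ⟩ := hF
  refine ⟨(differentiable_twist ω α).mul hFd, σ, fun s hs => ?_⟩
  obtain ⟨h1, h2⟩ := hσ s hs
  exact ⟨integrable_zetaIntegrand_dilate μ h1, by
    simp only [zetaIntegral_dilate, h2, mul_div_assoc]⟩

theorem isEntireContinuation_charSubgroup {V : Subgroup Kˣ} (hV : IsOpen (V : Set Kˣ))
    (hVU : V ≤ unitGroup K) {ω : Kˣ →ₜ* ℂˣ} (hω : ∀ v ∈ V, ω v = 1) :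
    IsEntireContinuation μ (charSubgroup V hV hVU) ω
      fun s => ((mulMeasure μ).real (V : Set Kˣ) : ℂ) * (localL ω s)⁻¹ :=
  ⟨(differentiable_localL_inv ω).const_mul _, 0, fun s _ =>
    ⟨integrable_zetaIntegrand_charSubgroup μ hV hVU hω s, by
      rw [zetaIntegral_charSubgroup μ hV hVU hω, div_eq_mul_inv]⟩⟩

/-- By `charSubgroup_unitGroup`, $\zeta(1_{\mathcal
O^\times})=(1-\omega(\pi)q^{-s})\,\zeta(1_{\mathcal O})$, and the left side is a volume. -/
theorem isEntireContinuation_charIntegers_of_unramified {ω : Kˣ →ₜ* ℂˣ} (hω : IsUnramified ω) :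
    IsEntireContinuation μ (charIntegers K) ω
      fun _ => ((mulMeasure μ).real (unitGroup K : Set Kˣ) : ℂ) := by
  obtain ⟨σ, hσ⟩ := exists_integrable_charIntegers μ ω
  refine ⟨differentiable_const _, σ, fun s hs => ⟨hσ s hs, ?_⟩⟩
  have hU : ∀ v ∈ unitGroup K, ω v = 1 := fun v hv => hω v (mem_unitGroup.1 hv)
  rw [← zetaIntegral_charSubgroup μ isOpen_unitGroup le_rfl hU s, charSubgroup_unitGroup,
    sub_eq_add_neg, ← neg_one_smul ℂ, zetaIntegral_add μ (hσ s hs)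
      (by rw [zetaIntegrand_smul]; exact (integrable_zetaIntegrand_dilate μ (hσ s hs)).smul _),
    zetaIntegral_smul, zetaIntegral_dilate, twist_primeElt_inv, localL, if_pos hω, div_inv_eq_mul]
  ring

theorem isEntireContinuation_charIntegers_of_ramified {ω : Kˣ →ₜ* ℂˣ} (hω : ¬ IsUnramified ω) :
    IsEntireContinuation μ (charIntegers K) ω fun _ => 0 := by
  obtain ⟨σ, hσ⟩ := exists_integrable_charIntegers μ ω
  refine ⟨differentiable_const _, σ, fun s hs => ⟨hσ s hs, ?_⟩⟩
  obtain ⟨u, hu, hne⟩ := exists_twist_ne_one hω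
  have h := zetaIntegral_dilate μ u (charIntegers K) ω s
  rw [dilate_charIntegers hu] at h
  rw [eq_zero_of_eq_mul_self (hne s) h, zero_div]

theorem exists_isEntireContinuation (g : SchwartzBruhat K) (ω : Kˣ →ₜ* ℂˣ) :
    ∃ F, IsEntireContinuation μ g ω F := by
  -- The continuable `g` form a subspace, so $1_{\mathcal O}$ and the dilates of small $1_V$ are
  -- enough.
  let P : Submodule ℂ (SchwartzBruhat K) :=
    { carrier := {g | ∃ F, IsEntireContinuation μ g ω F}
      add_mem' := fun ⟨F, hF⟩ ⟨G, hG⟩ => ⟨F + G, hF.add hG⟩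
      zero_mem' := by
        obtain ⟨V, hV, hVU, hω⟩ := exists_open_subgroup_trivial ω
        exact ⟨_, by
          simpa using (isEntireContinuation_charSubgroup μ hV hVU hω).smul 0⟩
      smul_mem' := fun c _ ⟨F, hF⟩ => ⟨c • F, hF.smul c⟩ }
  have hint : charIntegers K ∈ P := by
    by_cases h : IsUnramified ω
    · exact ⟨_, isEntireContinuation_charIntegers_of_unramified μ h⟩
    · exact ⟨_, isEntireContinuation_charIntegers_of_ramified μ h⟩
  have hzero : ∀ g : SchwartzBruhat K, (g : K → ℂ) 0 = 0 → g ∈ P := by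
    intro g hg
    obtain ⟨V₀, hV₀, -, hω⟩ := exists_open_subgroup_trivial ω
    obtain ⟨V, hV, hVU, hVV₀, hinv⟩ := exists_invariant_subgroup (isLocallyConstant_units g)
      (isCompact_support_units g hg) (hV₀.mem_nhds V₀.one_mem)
    obtain ⟨F, hF⟩ := exists_eq_sum_dilate g hg hV hVU hinv
    rw [hF]
    exact P.sum_mem fun a _ => P.smul_mem _ ⟨_, (isEntireContinuation_charSubgroup μ hV hVU
      fun v hv => hω v (hVV₀ hv)).dilate a⁻¹⟩
  have h := hzero (g - (g : K → ℂ) 0 • charIntegers K) (sub_smul_charIntegers_apply_zero g)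
  have := P.add_mem h (P.smul_mem ((g : K → ℂ) 0) hint)
  rwa [sub_add_cancel] at this

theorem isEntireContinuation_Z (g : SchwartzBruhat K) (ω : Kˣ →ₜ* ℂˣ) :
    IsEntireContinuation μ g ω (Z μ g ω) := by
  obtain ⟨F, hF⟩ := exists_isEntireContinuation μ g ω
  rwa [hF.Z_eq]

/-- The value of `Z(·,ω,s)` as a linear functional. -/
def ZLinear (ω : Kˣ →ₜ* ℂˣ) (s : ℂ) : SchwartzBruhat K →ₗ[ℂ] ℂ where
  toFun g := Z μ g ω s
  map_add' g h := by
    rw [((isEntireContinuation_Z μ g ω).add (isEntireContinuation_Z μ h ω)).Z_eq, Pi.add_apply]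
  map_smul' c g := by
    rw [((isEntireContinuation_Z μ g ω).smul c).Z_eq]
    rfl

theorem Z_dilate (α : Kˣ) (g : SchwartzBruhat K) (ω : Kˣ →ₜ* ℂˣ) (s : ℂ) :
    Z μ (dilate α g) ω s = twist ω s α * Z μ g ω s := by
  rw [((isEntireContinuation_Z μ g ω).dilate α).Z_eq]

/-- There is a test function at which `Z(·,ω,s)` is a nonzero constant and which detects every
functional transforming like `Z(·,ω,s)`. -/
theorem exists_test_function (ω : Kˣ →ₜ* ℂˣ) :
    ∃ (g₀ : SchwartzBruhat K) (c : ℂ), c ≠ 0 ∧ (∀ s, Z μ g₀ ω s = c) ∧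
      ∀ (s : ℂ) (Λ : SchwartzBruhat K →ₗ[ℂ] ℂ),
        (∀ α g, Λ (dilate α g) = twist ω s α * Λ g) → Λ g₀ = 0 → Λ = 0 := by
  by_cases h : IsUnramified ω
  · refine ⟨charIntegers K, ((mulMeasure μ).real (unitGroup K : Set Kˣ) : ℂ), ?_, fun s => ?_,
      fun s Λ hΛ h0 => ?_⟩
    · exact_mod_cast (measureReal_subgroup_pos μ isOpen_unitGroup le_rfl).ne'
    · rw [(isEntireContinuation_charIntegers_of_unramified μ h).Z_eq]
    · refine eq_zero_of_equivariant Λ (twist ω s) hΛ isOpen_unitGroup le_rfl (fun v hv => ?_) ?_ h0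
      · rw [twist_of_mem ω s hv, h v (mem_unitGroup.1 hv), Units.val_one, inv_one]
      · rw [charSubgroup_unitGroup, map_sub, hΛ, h0, mul_zero, sub_zero]
  -- In the ramified case $L=1$, so $Z(1_V)$ is the volume of $V$ for every `s`.
  · obtain ⟨V, hV, hVU, hω⟩ := exists_open_subgroup_trivial ω
    refine ⟨charSubgroup V hV hVU, ((mulMeasure μ).real (V : Set Kˣ) : ℂ), ?_, fun s => ?_,
      fun s Λ hΛ h0 => ?_⟩
    · exact_mod_cast (measureReal_subgroup_pos μ hV hVU).ne'
    · rw [(isEntireContinuation_charSubgroup μ hV hVU hω).Z_eq]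
      simp only [localL, if_neg h, inv_one, mul_one]
    · refine eq_zero_of_equivariant Λ (twist ω s) hΛ hV hVU (fun v hv => ?_) h0 ?_
      · rw [twist_of_mem ω s (hVU hv), hω v hv, Units.val_one, inv_one]
      · obtain ⟨u, hu, hne⟩ := exists_twist_ne_one h
        have := hΛ u (charIntegers K)
        rw [dilate_charIntegers hu] at this
        exact eq_zero_of_eq_mul_self (hne s) this

/-- Dilation by $\alpha^{-1}$ against $(\omega^{-1},n-s)$ contributes
$\omega(\alpha)^{-1}|\alpha|^{n-s}$, and the factor $|\alpha|^{-n}$ from `hT` removes the $n$. -/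
theorem Z_comp_equivariant {T : SchwartzBruhat K →ₗ[ℂ] SchwartzBruhat K} {n : ℤ}
    (hT : ∀ (g : SchwartzBruhat K) (α : Kˣ),
      T (dilate α g) = ((absVal α : ℂ) ^ (-n)) • dilate α⁻¹ (T g))
    (ω : Kˣ →ₜ* ℂˣ) (s : ℂ) (α : Kˣ) (g : SchwartzBruhat K) :
    Z μ (T (dilate α g)) ω⁻¹ (n - s) = twist ω s α * Z μ (T g) ω⁻¹ (n - s) := by
  have h : (absVal α : ℂ) ^ (-n) * twist ω⁻¹ (n - s) α⁻¹ = twist ω s α := by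
    have h1 : (ω⁻¹ : Kˣ →ₜ* ℂˣ) α⁻¹ = ω α := by
      change (ω α⁻¹)⁻¹ = ω α
      rw [map_inv, inv_inv]
    have h2 : ((absVal α⁻¹ : ℝ) : ℂ) ^ (-((n : ℂ) - s)) = (absVal α : ℂ) ^ ((n : ℂ) - s) := by
      rw [absVal_inv, Complex.ofReal_inv, Complex.inv_cpow, Complex.cpow_neg, inv_inv]
      rw [Complex.arg_ofReal_of_nonneg (absVal_pos α).le]
      exact Real.pi_pos.ne
    rw [twist, twist, h1, h2, sub_eq_add_neg, Complex.cpow_add _ _ (absVal_ne_zero α),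
      Complex.cpow_intCast, zpow_neg]
    have h3 : (absVal α : ℂ) ^ n ≠ 0 := zpow_ne_zero n (absVal_ne_zero α)
    field_simp
  rw [hT, ((isEntireContinuation_Z μ _ _).smul _).Z_eq, Pi.smul_apply, Z_dilate, smul_eq_mul,
    ← mul_assoc, h]

end Continuation

end LocalZeta

end

theorem mainTheorem7 {K : Type*} [Field K] [ValuativeRel K] [TopologicalSpace K]
    [IsNonarchimedeanLocalField K] [MeasurableSpace K] [BorelSpace K]
    (μ : Measure K) [μ.IsAddHaarMeasure]
    (T : LocalZeta.SchwartzBruhat K →ₗ[ℂ] LocalZeta.SchwartzBruhat K) (n : ℤ)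
    (hT : ∀ (g : LocalZeta.SchwartzBruhat K) (α : Kˣ),
      T (LocalZeta.dilate α g) =
        ((LocalZeta.absVal α : ℂ) ^ (-n)) • LocalZeta.dilate α⁻¹ (T g)) :
    ∀ ω : Kˣ →ₜ* ℂˣ,
      (∀ g : LocalZeta.SchwartzBruhat K,
        LocalZeta.IsEntireContinuation μ g ω (LocalZeta.Z μ g ω)) ∧
      ∃! ε : ℂ → ℂ, Differentiable ℂ ε ∧
        ∀ (g : LocalZeta.SchwartzBruhat K) (s : ℂ),
          LocalZeta.Z μ (T g) ω⁻¹ ((n : ℂ) - s) = ε s * LocalZeta.Z μ g ω s := by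
  intro ω
  refine ⟨fun g => LocalZeta.isEntireContinuation_Z μ g ω, ?_⟩
  obtain ⟨g₀, c, hc, hZ, hdet⟩ := LocalZeta.exists_test_function μ ω
  refine ⟨fun s => LocalZeta.Z μ (T g₀) ω⁻¹ (n - s) / c, ⟨?_, fun g s => ?_⟩, ?_⟩
  · exact ((LocalZeta.isEntireContinuation_Z μ (T g₀) ω⁻¹).1.comp
      ((differentiable_const _).sub differentiable_id)).div_const c
  -- This combination of the two functionals is equivariant and is built to vanish at `g₀`, hence is
  -- zero.
  · have h := hdet s (c • (LocalZeta.ZLinear μ ω⁻¹ (n - s)).comp T -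
      LocalZeta.Z μ (T g₀) ω⁻¹ (n - s) • LocalZeta.ZLinear μ ω s) (fun α g => by
        change c * LocalZeta.Z μ (T (LocalZeta.dilate α g)) ω⁻¹ (n - s) -
          LocalZeta.Z μ (T g₀) ω⁻¹ (n - s) * LocalZeta.Z μ (LocalZeta.dilate α g) ω s =
          LocalZeta.twist ω s α * (c * LocalZeta.Z μ (T g) ω⁻¹ (n - s) -
            LocalZeta.Z μ (T g₀) ω⁻¹ (n - s) * LocalZeta.Z μ g ω s)
        rw [LocalZeta.Z_comp_equivariant μ hT, LocalZeta.Z_dilate]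
        ring) (by
        change c * LocalZeta.Z μ (T g₀) ω⁻¹ (n - s) -
          LocalZeta.Z μ (T g₀) ω⁻¹ (n - s) * LocalZeta.Z μ g₀ ω s = 0
        rw [hZ]
        ring)
    have hg : c * LocalZeta.Z μ (T g) ω⁻¹ (n - s) -
        LocalZeta.Z μ (T g₀) ω⁻¹ (n - s) * LocalZeta.Z μ g ω s = 0 := LinearMap.congr_fun h g
    rw [div_mul_eq_mul_div, eq_div_iff hc]
    linear_combination hg
  -- Evaluating the functional equation at `g₀`, where `Z` equals `c ≠ 0`, determines `ε`.
  · rintro ε ⟨-, hε⟩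
    funext s
    rw [eq_div_iff hc, hε, hZ]
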